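/- Let $\Omega\subset\mathbb R^2$ be open and convex, $k\ge 1$, and let $A:\Omega\to\mathbb C^{2\times2}$, $A=\begin{pmatrix}a&b\\c&d\end{pmatrix}$, be of class $C^k$. Put $\Delta=(a-d)^2+4bc$ and $F=(\operatorname{Re}\Delta,\operatorname{Im}\Delta):\Omega\to\mathbb R^2$. A point $\xi\in\Omega$ is called a generic cuspidal point (GCP) of $A$ if $F(\xi)=0$ (so the two eigenvalues of $A(\xi)$ coalesce) and the Jacobian $DF(\xi)$ is invertible. Let $\xi_0\neq\xi_1$ be two GCPs of $A$ in $\Omega$, and suppose that $A(\xi)$ has two distinct eigenvalues for every $\xi\in\Omega\setminus\{\xi_0,\xi_1\}$. Let $\gamma:\mathbb R\to\mathbb R^2$ be a smooth Jordan curve with image $\Gamma\subset\Omega$, that is, $\gamma$ is $C^1$, satisfies $\gamma(t+1)=\gamma(t)$ for all $t$, and is one-to-one on $[0,1)$. Suppose that $\Gamma$ encloses both points, i.e. $\xi_0$ and $\xi_1$ lie in the bounded connected component of $\mathbb R^2\setminus\Gamma$. Let $$A(\gamma(t))=V(t)\,\operatorname{diag}(\lambda_1(t),\lambda_2(t))\,V(t)^{-1},\qquad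 t\in\mathbb R,$$ be an eigendecomposition in which $V$ (invertible for all $t$), $\lambda_1$ and $\lambda_2$ are of class $C^k$ on $\mathbb R$ and in which, writing $v_1,v_2$ for the columns of $V$ and $P=V^{-1}\dot V$, for all $t\in\mathbb R$ and $j=1,2$, $$\operatorname{Re}(v_j^*v_jP_{jj})=-\sum_{k\neq j}\operatorname{Re}(v_j^*v_kP_{kj})\qquad\text{and}\qquad \operatorname{Im}P_{jj}=0$$ (the first condition says that the columns of $V$ have constant Euclidean length, the second is parallel transport). Then: (i) $\lambda_1(t+1)=\lambda_1(t)$ and $\lambda_2(t+1)=\lambda_2(t)$ for all $t\in\mathbb R$; (ii) there are real constants $\alpha_1,\alpha_2$ with $\alpha_1+\alpha_2\equiv0\pmod{2\pi}$ such that $$V(t)^{-1}V(t+1)=\begin{pmatrix}e^{i\alpha_1}&0\\0&e^{i\alpha_2}\end{pmatrix}\quad\text{for all }t\in\mathbb R.$$ -/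

import Mathlib

/-- The parameter plane `ℝ²`. -/
abbrev ParamPlane : Type := EuclideanSpace ℝ (Fin 2)

/-- A complex matrix has simple spectrum: its eigenvalues, counted with algebraic multiplicity,
are pairwise distinct. -/
def HasSimpleSpectrum {n : ℕ} (M : Matrix (Fin n) (Fin n) ℂ) : Prop :=
  M.charpoly.roots.Nodup

/-- A matrix function of two real parameters is of class `C^k` on `Ω` (entry by entry). -/
def MatrixContDiffOn {n : ℕ} (k : WithTop ℕ∞) (A : ParamPlane → Matrix (Fin n) (Fin n) ℂ)
    (Ω : Set ParamPlane) : Prop :=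
  ∀ i j, ContDiffOn ℝ k (fun ξ => A ξ i j) Ω

/-- The discriminant `Δ = (a - d)² + 4 b c` of the characteristic polynomial of the `2 × 2`
matrix with rows `(a, b)` and `(c, d)`. -/
def discriminant2 (A : ParamPlane → Matrix (Fin 2) (Fin 2) ℂ) (ξ : ParamPlane) : ℂ :=
  (A ξ 0 0 - A ξ 1 1) ^ 2 + 4 * A ξ 0 1 * A ξ 1 0

/-- The real planar map `F = (Re Δ, Im Δ)`. -/
noncomputable def discriminantMap (A : ParamPlane → Matrix (Fin 2) (Fin 2) ℂ)
    (ξ : ParamPlane) : ParamPlane :=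
  !₂[(discriminant2 A ξ).re, (discriminant2 A ξ).im]

/-- `ξ₀` is a generic cuspidal point of the `2 × 2` matrix function `A`: `F(ξ₀) = 0` (that is,
the two eigenvalues of `A ξ₀` coalesce) and the Jacobian `DF(ξ₀)` is invertible. -/
def IsGenericCuspidalPoint (A : ParamPlane → Matrix (Fin 2) (Fin 2) ℂ) (ξ₀ : ParamPlane) : Prop :=
  discriminantMap A ξ₀ = 0 ∧ (fderiv ℝ (discriminantMap A) ξ₀).IsInvertible

/-- A smooth (i.e. `C^1`) parametrized Jordan curve in the plane: a `1`-periodic `C^1` map which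
is one-to-one on `[0, 1)`. -/
structure IsSmoothJordanCurve (γ : ℝ → ParamPlane) : Prop where
  contDiff : ContDiff ℝ 1 γ
  periodic : Function.Periodic γ 1
  injOn : Set.InjOn γ (Set.Ico 0 1)

/-- `U` is the interior region of the Jordan curve `γ`: the bounded connected component of the
complement of the image of `γ` (it exists and is unique by the Jordan curve theorem). -/
def IsInteriorOfCurve (γ : ℝ → ParamPlane) (U : Set ParamPlane) : Prop :=
  (∃ x ∈ (Set.range γ)ᶜ, U = connectedComponentIn (Set.range γ)ᶜ x) ∧ Bornology.IsBounded U

/-- The entrywise derivative of a matrix function of one real variable. -/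
noncomputable def matrixDeriv {n : ℕ} (V : ℝ → Matrix (Fin n) (Fin n) ℂ) (t : ℝ) :
    Matrix (Fin n) (Fin n) ℂ :=
  Matrix.of fun i j => deriv (fun s => V s i j) t

/-- The matrix function `P = V⁻¹ V̇`, so that `V̇ = V P`. -/
noncomputable def transportMatrix {n : ℕ} (V : ℝ → Matrix (Fin n) (Fin n) ℂ) (t : ℝ) :
    Matrix (Fin n) (Fin n) ℂ :=
  (V t)⁻¹ * matrixDeriv V t

/-- `B(t) = V(t) diag(lam₁(t), …, lamₙ(t)) V(t)⁻¹` is a `C^k` eigendecomposition of the matrix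
function `B` on the real line. -/
structure IsEigendecomposition {n : ℕ} (k : WithTop ℕ∞) (B V : ℝ → Matrix (Fin n) (Fin n) ℂ)
    (lam : Fin n → ℝ → ℂ) : Prop where
  contDiff_vectors : ∀ i j, ContDiff ℝ k (fun t => V t i j)
  contDiff_values : ∀ j, ContDiff ℝ k (lam j)
  isUnit_det : ∀ t, IsUnit (V t).det
  eq : ∀ t, B t = V t * Matrix.diagonal (fun j => lam j t) * (V t)⁻¹

/-- The condition `Re (v_j^* v_j P_jj) = - ∑_{k ≠ j} Re (v_j^* v_k P_kj)`, where `v_j` is the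
`j`-th column of `V`, `P = V⁻¹ V̇`, and `(Vᴴ V)_jk = v_j^* v_k`. It says that the columns have
constant Euclidean length. -/
def SatisfiesConstantLength {n : ℕ} (V : ℝ → Matrix (Fin n) (Fin n) ℂ) : Prop :=
  ∀ t j, (((V t).conjTranspose * V t) j j * transportMatrix V t j j).re =
    - ∑ k ∈ Finset.univ.erase j,
        (((V t).conjTranspose * V t) j k * transportMatrix V t k j).re

/-- The parallel transport condition `Im P_jj = 0`, where `P = V⁻¹ V̇`. -/
def SatisfiesParallelTransport {n : ℕ} (V : ℝ → Matrix (Fin n) (Fin n) ℂ) : Prop :=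
  ∀ t j, (transportMatrix V t j j).im = 0

/-! Along `γ` one has `(lam 0 - lam 1)² = Δ ∘ γ`, so everything depends on whether the loop `Δ ∘ γ`
in `ℂ \ {0}` has a periodic square root, i.e. on the parity of its winding number. `PeriodicSqEquiv`
encodes this parity as a class modulo squares. Near a GCP, `Δ` behaves like an invertible
real-linear map, which is the identity up to a square (`exists_realLinear_eq_mul_sq`). Dividing both
zeros out leaves a nonvanishing function on a convex set, whose class is trivial. The two remaining
factors `γ - ξ₀` and `γ - ξ₁` have the same class, because the points lie in one component of the
complement of `Γ`; their product is therefore a square (`exists_periodic_sqrt_comp`).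

Hence the difference of the eigenvalues is periodic; so is their sum, the trace. Then `V t` and `V
(t + 1)` diagonalize the same matrix in the same order, and the monodromy is diagonal. Constant
length makes its entries unimodular, and parallel transport makes them constant (`monodromy_const`).
Finally `(det V)' = det V · tr P` with `tr P` real, so `det V` keeps its argument and the monodromy
has determinant one. -/

open Topology Filter

/-! ### Loops in `ℂ \ {0}` modulo periodic squares -/

/-- `u` and `v` differ by the square of a continuous, nonvanishing, `1`-periodic function. -/
def PeriodicSqEquiv (u v : ℝ → ℂ) : Prop :=
  ∃ r : ℝ → ℂ, Continuous r ∧ Function.Periodic r 1 ∧ (∀ t, r t ≠ 0) ∧ ∀ t, u t = r t ^ 2 * v t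

namespace PeriodicSqEquiv

variable {u v w u' v' : ℝ → ℂ}

lemma trans (h : PeriodicSqEquiv u v) (h' : PeriodicSqEquiv v w) : PeriodicSqEquiv u w := by
  obtain ⟨r, hr, hp, h0, he⟩ := h
  obtain ⟨s, hs, hq, h1, hf⟩ := h'
  refine ⟨fun t => r t * s t, hr.mul hs, hp.mul hq, fun t => mul_ne_zero (h0 t) (h1 t),
    fun t => ?_⟩
  rw [he, hf]
  ring

lemma symm (h : PeriodicSqEquiv u v) : PeriodicSqEquiv v u := by
  obtain ⟨r, hr, hp, h0, he⟩ := h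
  refine ⟨fun t => (r t)⁻¹, hr.inv₀ h0, fun t => by simp [hp t], fun t => inv_ne_zero (h0 t),
    fun t => ?_⟩
  have := h0 t
  rw [he]
  field_simp

lemma mul (h : PeriodicSqEquiv u v) (h' : PeriodicSqEquiv u' v') :
    PeriodicSqEquiv (fun t => u t * u' t) (fun t => v t * v' t) := by
  obtain ⟨r, hr, hp, h0, he⟩ := h
  obtain ⟨s, hs, hq, h1, hf⟩ := h'
  refine ⟨fun t => r t * s t, hr.mul hs, hp.mul hq, fun t => mul_ne_zero (h0 t) (h1 t),
    fun t => ?_⟩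
  simp only [he t, hf t]
  ring

lemma sq_of_eq (hu : Continuous u) (hp : Function.Periodic u 1) (h0 : ∀ t, u t ≠ 0) :
    PeriodicSqEquiv (fun t => u t * u t) (fun _ => 1) :=
  ⟨u, hu, hp, h0, fun t => by ring⟩

end PeriodicSqEquiv

lemma Complex.continuousAt_cpow_half {z : ℂ} (hz : z ∈ Complex.slitPlane) :
    ContinuousAt (fun w : ℂ => w ^ (1 / 2 : ℂ)) z :=
  continuousAt_cpow_const hz

lemma Complex.cpow_half_sq (z : ℂ) : (z ^ (1 / 2 : ℂ)) ^ 2 = z := by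
  rw [← Complex.cpow_mul_nat]
  simp

lemma Complex.cpow_half_ne_zero {z : ℂ} (hz : z ≠ 0) : z ^ (1 / 2 : ℂ) ≠ 0 := fun h => by
  have := Complex.cpow_half_sq z
  rw [h] at this
  exact hz (by simpa using this.symm)

/-- Loops in `ℂ \ {0}` belonging to a family with connected parameter space are equivalent. -/
lemma periodicSqEquiv_of_family {X : Type*} [TopologicalSpace X] [PreconnectedSpace X]
    (H : X → ℝ → ℂ) (hc : Continuous fun p : X × ℝ => H p.1 p.2) (h0 : ∀ x t, H x t ≠ 0)
    (hp : ∀ x, Function.Periodic (H x) 1) (x y : X) : PeriodicSqEquiv (H x) (H y) := by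
  refine (isPreconnected_univ (α := X)).induction₂ (fun x y => PeriodicSqEquiv (H x) (H y))
    (fun x _ => ?_) (fun x y z _ _ _ h h' => h.trans h') (fun x y _ _ h => h.symm)
    (Set.mem_univ x) (Set.mem_univ y)
  rw [nhdsWithin_univ]
  -- The quotient is 1 at `y = x`; compactness of a period keeps it off the cut of the principal
  -- square root for all nearby `y`.
  have key : ∀ᶠ y in 𝓝 x, ∀ t ∈ Set.Icc (0 : ℝ) 1, H x t / H y t ∈ Complex.slitPlane := by
    refine isCompact_Icc.eventually_forall_of_forall_eventually fun t _ => ?_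
    have hd : Continuous fun p : X × ℝ => H x p.2 / H p.1 p.2 :=
      (hc.comp (by fun_prop : Continuous fun p : X × ℝ => (x, p.2))).div hc fun p => h0 _ _
    refine hd.continuousAt.eventually (Complex.isOpen_slitPlane.mem_nhds ?_)
    simp [div_self (h0 x t)]
  filter_upwards [key] with y hy
  have hper : Function.Periodic (fun t => H x t / H y t) 1 := fun t => by
    simp only [hp x t, hp y t]
  have hy' : ∀ t, H x t / H y t ∈ Complex.slitPlane := fun t => by
    have h := hper.sub_int_mul_eq ⌊t⌋ (x := t)
    rw [← h]
    refine hy _ ⟨?_, ?_⟩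
    · simp
    · simpa using (Int.fract_lt_one t).le
  refine ⟨fun t => (H x t / H y t) ^ (1 / 2 : ℂ), ?_, fun t => ?_, fun t => ?_, fun t => ?_⟩
  · have h1 : ∀ x, Continuous (H x) := fun x =>
      hc.comp (by fun_prop : Continuous fun t : ℝ => (x, t))
    exact continuous_iff_continuousAt.2 fun t =>
      (Complex.continuousAt_cpow_half (hy' t)).comp
        (f := fun t => H x t / H y t) ((h1 x).div (h1 y) (h0 y)).continuousAt
  · simp only [hp x t, hp y t]
  · exact Complex.cpow_half_ne_zero (div_ne_zero (h0 x t) (h0 y t))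
  · rw [Complex.cpow_half_sq, div_mul_cancel₀ _ (h0 y t)]

/-! ### Nondegenerate zeros of planar maps -/

open ComplexConjugate in
/-- An injective real-linear endomorphism `z ↦ L z` of `ℂ` has the form `z * m z ^ 2` with `m`
continuous and nonvanishing on `ℂ \ {0}`. -/
lemma exists_realLinear_eq_mul_sq (L : ℂ →L[ℝ] ℂ) (hL : Function.Injective L) :
    ∃ m : ℂ → ℂ, ContinuousOn m {0}ᶜ ∧ ∀ z, z ≠ 0 → m z ≠ 0 ∧ L z = m z ^ 2 * z := by
  obtain ⟨a, b, hab⟩ : ∃ a b : ℂ, ∀ z, L z = a * z + b * conj z := by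
    refine ⟨(L 1 - Complex.I * L Complex.I) / 2, (L 1 + Complex.I * L Complex.I) / 2, fun z => ?_⟩
    have h : L z = z.re * L 1 + z.im * L Complex.I := by
      have : z = z.re • (1 : ℂ) + z.im • Complex.I := by simp
      conv_lhs => rw [this]
      rw [map_add, map_smul, map_smul]
      simp
    have hz : conj z = z.re - z.im * Complex.I := by
      apply Complex.ext <;> simp
    rw [h, hz]
    conv_rhs => rw [← Complex.re_add_im z]
    simp only [Complex.add_re, Complex.add_im, Complex.ofReal_re, Complex.ofReal_im,
      Complex.re_ofReal_mul, Complex.im_ofReal_mul, Complex.I_re, Complex.I_im]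
    push_cast
    linear_combination ((z.im : ℂ) * L Complex.I) * Complex.I_sq
  have hne : ∀ z : ℂ, z ≠ 0 → a * z + b * conj z ≠ 0 := fun z hz h => by
    refine hz (hL ?_)
    rw [hab, h, map_zero]
  -- If `‖a‖ = ‖b‖`, a square root `w` of `-b / a` is unimodular and lies in the kernel of `L`.
  have hnorm : ‖a‖ ≠ ‖b‖ := fun h => by
    have ha : a ≠ 0 := fun ha => by
      have hb : b = 0 := by simpa [ha, eq_comm] using h
      exact hne 1 one_ne_zero (by simp [ha, hb])
    set w := (-b / a) ^ (1 / 2 : ℂ) with hw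
    have hw2 : w ^ 2 = -b / a := Complex.cpow_half_sq _
    have hwn : ‖w‖ ^ 2 = 1 := by
      rw [← norm_pow, hw2, norm_div, norm_neg, ← h, div_self (by simpa using ha)]
    have hww : w * conj w = 1 := by
      rw [Complex.mul_conj, Complex.normSq_eq_norm_sq, hwn]
      simp
    have hw0 : w ≠ 0 := left_ne_zero_of_mul_eq_one hww
    refine hne w hw0 (mul_left_cancel₀ hw0 ?_)
    have : a * w ^ 2 = -b := by
      rw [hw2]
      field_simp
    linear_combination this + b * hww
  have hslit : ∀ c d z : ℂ, ‖d‖ < ‖c‖ → ‖z‖ = 1 → 1 + d / c * z ∈ Complex.slitPlane := by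
    intro c d z hcd hz
    refine Complex.mem_slitPlane_of_norm_lt_one ?_
    rw [norm_mul, hz, mul_one, norm_div]
    exact (div_lt_one (lt_of_le_of_lt (norm_nonneg _) hcd)).2 hcd
  have hroot : ∀ (c d : ℂ) (k : ℂ → ℂ), ‖d‖ < ‖c‖ → ContinuousOn k {0}ᶜ →
      (∀ z, z ≠ 0 → ‖k z‖ = 1) →
      ∃ m : ℂ → ℂ, ContinuousOn m {0}ᶜ ∧ ∀ z, z ≠ 0 → m z ≠ 0 ∧ m z ^ 2 = c + d * k z := by
    intro c d k hcd hk hk1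
    have hc : c ≠ 0 := norm_pos_iff.1 (lt_of_le_of_lt (norm_nonneg _) hcd)
    refine ⟨fun z => c ^ (1 / 2 : ℂ) * (1 + d / c * k z) ^ (1 / 2 : ℂ), ?_, fun z hz => ⟨?_, ?_⟩⟩
    · refine continuousOn_const.mul fun z hz => ?_
      exact (Complex.continuousAt_cpow_half (hslit c d _ hcd (hk1 z hz))).comp_continuousWithinAt
        (f := fun z => 1 + d / c * k z)
        (continuousOn_const.add (continuousOn_const.mul hk) z hz)
    · exact mul_ne_zero (Complex.cpow_half_ne_zero hc) (Complex.cpow_half_ne_zero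
        (Complex.slitPlane_ne_zero (hslit c d _ hcd (hk1 z hz))))
    · rw [mul_pow, Complex.cpow_half_sq, Complex.cpow_half_sq]
      field_simp
  have hconj : ContinuousOn (fun z : ℂ => conj z) {0}ᶜ := Complex.continuous_conj.continuousOn
  -- The orientation-reversing case factors out `conj z = (‖z‖ / z)² z`, the other one `z`; what
  -- remains stays in a disc that misses 0.
  rcases hnorm.lt_or_gt with h | h
  · obtain ⟨m, hm, hm'⟩ := hroot b a (fun z => z / conj z) h
      (continuousOn_id.div hconj fun z hz => by simpa using hz)
      (fun z hz => by simp [hz])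
    have hn : ContinuousOn (fun z : ℂ => (‖z‖ : ℂ)) {0}ᶜ := by fun_prop
    refine ⟨fun z => m z * (‖z‖ / z), hm.mul (hn.div continuousOn_id fun z hz => hz),
      fun z hz => ⟨?_, ?_⟩⟩
    · exact mul_ne_zero (hm' z hz).1 (div_ne_zero (by simpa using hz) hz)
    · have hz' : conj z ≠ 0 := by simpa using hz
      have hzz : (‖z‖ : ℂ) ^ 2 = z * conj z := by
        rw [Complex.mul_conj, Complex.normSq_eq_norm_sq]
        simp
      rw [mul_pow, div_pow, (hm' z hz).2, hzz, hab]
      field_simp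
      ring
  · obtain ⟨m, hm, hm'⟩ := hroot a b (fun z => conj z / z) h
      (hconj.div continuousOn_id fun z hz => hz)
      (fun z hz => by simp [hz])
    refine ⟨m, hm, fun z hz => ⟨(hm' z hz).1, ?_⟩⟩
    rw [(hm' z hz).2, hab]
    field_simp

/-- If `f` vanishes at `z₀` with invertible derivative `L`, then `f z / L (z - z₀) → 1`. -/
lemma tendsto_div_fderiv {f : ℂ → ℂ} {L : ℂ →L[ℝ] ℂ} {z₀ : ℂ} (hf : HasFDerivAt f L z₀)
    (hL : Function.Injective L) (h0 : f z₀ = 0) :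
    Tendsto (fun z => f z / L (z - z₀)) (𝓝[≠] z₀) (𝓝 1) := by
  obtain ⟨K, hK⟩ : ∃ K, AntilipschitzWith K L := by
    obtain ⟨K, -, hK⟩ := L.toLinearMap.exists_antilipschitzWith (LinearMap.ker_eq_bot.2 hL)
    exact ⟨K, hK⟩
  have h1 : (fun z => f z - L (z - z₀)) =o[𝓝 z₀] fun z => L (z - z₀) := by
    have := hf.isLittleO
    simp only [h0, sub_zero] at this
    refine this.trans_isBigO (Asymptotics.IsBigO.of_bound K (Eventually.of_forall fun z => ?_))
    exact hK.le_mul_norm (map_zero L) (z - z₀)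
  have h2 := (h1.mono (nhdsWithin_le_nhds (s := {z₀}ᶜ))).tendsto_div_nhds_zero
  have h3 := h2.add_const 1
  rw [zero_add] at h3
  refine h3.congr' ?_
  filter_upwards [self_mem_nhdsWithin] with z hz
  have : L (z - z₀) ≠ 0 := fun h => hz (sub_eq_zero.1 (hL (h.trans (map_zero L).symm)))
  field_simp
  ring

/-- The loop `f ∘ γ` has a continuous periodic square root, if `f` has exactly two zeros in a
convex set, both nondegenerate and in one connected subset of the complement of `γ`. -/
lemma exists_periodic_sqrt_comp {Ω U : Set ℂ} (hΩ : Convex ℝ Ω) {f : ℂ → ℂ}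
    (hf : ContinuousOn f Ω) {z₀ z₁ : ℂ} (hne : z₀ ≠ z₁) (hz₀ : z₀ ∈ Ω)
    (hf0 : ∀ z ∈ Ω, z ≠ z₀ → z ≠ z₁ → f z ≠ 0) (h₀ : f z₀ = 0) (h₁ : f z₁ = 0)
    {L₀ L₁ : ℂ →L[ℝ] ℂ} (hd₀ : HasFDerivAt f L₀ z₀) (hd₁ : HasFDerivAt f L₁ z₁)
    (hL₀ : Function.Injective L₀) (hL₁ : Function.Injective L₁)
    {γ : ℝ → ℂ} (hγ : Continuous γ) (hp : Function.Periodic γ 1) (hγΩ : ∀ t, γ t ∈ Ω)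
    (hU : IsPreconnected U) (hγU : ∀ t, γ t ∉ U) (hz₀U : z₀ ∈ U) (hz₁U : z₁ ∈ U) :
    PeriodicSqEquiv (fun t => f (γ t)) fun _ => 1 := by
  have hLne : ∀ L : ℂ →L[ℝ] ℂ, Function.Injective L → ∀ z w, z ≠ w → L (z - w) ≠ 0 :=
    fun L hL z w hzw h => hzw (sub_eq_zero.1 (hL (h.trans (map_zero L).symm)))
  have hγ0 : ∀ p ∈ U, ∀ t, γ t - p ≠ 0 := fun p hp t h => hγU t (by rwa [sub_eq_zero.1 h])
  -- moving `z₀` to `z₁` inside `U`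
  have hmove : PeriodicSqEquiv (fun t => γ t - z₀) fun t => γ t - z₁ := by
    have := isPreconnected_iff_preconnectedSpace.1 hU
    exact periodicSqEquiv_of_family (fun (p : U) t => γ t - p) (by fun_prop)
      (fun p t => hγ0 p p.2 t) (fun p t => by simp only [hp t]) ⟨z₀, hz₀U⟩ ⟨z₁, hz₁U⟩
  -- removing the linear parts
  have hlin : ∀ L : ℂ →L[ℝ] ℂ, Function.Injective L → ∀ p ∈ U,
      PeriodicSqEquiv (fun t => L (γ t - p)) fun t => γ t - p := by
    intro L hL p hpU
    obtain ⟨m, hm, hm'⟩ := exists_realLinear_eq_mul_sq L hL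
    exact ⟨fun t => m (γ t - p), hm.comp_continuous (by fun_prop) fun t => hγ0 p hpU t,
      fun t => by simp only [hp t], fun t => (hm' _ (hγ0 p hpU t)).1,
      fun t => (hm' _ (hγ0 p hpU t)).2⟩
  -- the quotient of `f` by its linear parts extends to a continuous nonvanishing function
  set q : ℂ → ℂ := fun z => f z / (L₀ (z - z₀) * L₁ (z - z₁)) with hq
  -- The values at the zeros are forced: `f / L` tends to 1 at each, leaving the inverse of the
  -- other linear factor.
  set g : ℂ → ℂ := Function.update (Function.update q z₀ (L₁ (z₀ - z₁))⁻¹) z₁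
    (L₀ (z₁ - z₀))⁻¹ with hg
  have hgq : ∀ z, z ≠ z₀ → z ≠ z₁ → g z = q z := fun z h h' => by
    rw [hg, Function.update_of_ne h', Function.update_of_ne h]
  have hg₀ : g z₀ = (L₁ (z₀ - z₁))⁻¹ := by
    rw [hg, Function.update_of_ne hne, Function.update_self]
  have hg₁ : g z₁ = (L₀ (z₁ - z₀))⁻¹ := Function.update_self ..
  have hg0 : ∀ z ∈ Ω, g z ≠ 0 := by
    intro z hz
    by_cases h : z = z₀
    · rw [h, hg₀]
      exact inv_ne_zero (hLne L₁ hL₁ _ _ hne)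
    by_cases h' : z = z₁
    · rw [h', hg₁]
      exact inv_ne_zero (hLne L₀ hL₀ _ _ hne.symm)
    rw [hgq z h h']
    exact div_ne_zero (hf0 z hz h h') (mul_ne_zero (hLne L₀ hL₀ _ _ h) (hLne L₁ hL₁ _ _ h'))
  have hgat : ∀ (L M : ℂ →L[ℝ] ℂ) (z w : ℂ), HasFDerivAt f L z → Function.Injective L →
      Function.Injective M → f z = 0 → z ≠ w → g z = (M (z - w))⁻¹ →
      (∀ x, x ≠ z → x ≠ w → g x = f x / (L (x - z) * M (x - w))) → ContinuousAt g z := by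
    intro L M z w hd hL hM h0 hzw hgz hgx
    rw [continuousAt_iff_punctured_nhds, hgz]
    have h1 : Tendsto (fun x => (M (x - w))⁻¹) (𝓝[≠] z) (𝓝 (M (z - w))⁻¹) := by
      have : ContinuousAt (fun x => (M (x - w))⁻¹) z :=
        ContinuousAt.inv₀ (by fun_prop) (hLne M hM _ _ hzw)
      exact this.tendsto.mono_left nhdsWithin_le_nhds
    have h2 := (tendsto_div_fderiv hd hL h0).mul h1
    rw [one_mul] at h2
    refine h2.congr' ?_
    filter_upwards [self_mem_nhdsWithin, nhdsWithin_le_nhds (isOpen_ne.mem_nhds hzw)] with x hx hx'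
    rw [hgx x hx hx', div_eq_mul_inv, div_eq_mul_inv, mul_inv, mul_assoc]
  have hgc : ContinuousOn g Ω := by
    intro z hz
    by_cases h : z = z₀
    · rw [h]
      exact (hgat L₀ L₁ z₀ z₁ hd₀ hL₀ hL₁ h₀ hne hg₀ hgq).continuousWithinAt
    by_cases h' : z = z₁
    · rw [h']
      refine (hgat L₁ L₀ z₁ z₀ hd₁ hL₁ hL₀ h₁ hne.symm hg₁ fun x hx hx' => ?_).continuousWithinAt
      rw [hgq x hx' hx, mul_comm]
    have hqc : ContinuousWithinAt q Ω z :=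
      (hf z hz).div (by fun_prop) (mul_ne_zero (hLne L₀ hL₀ _ _ h) (hLne L₁ hL₁ _ _ h'))
    refine hqc.congr_of_eventuallyEq ?_ (hgq z h h')
    filter_upwards [nhdsWithin_le_nhds (isOpen_ne.mem_nhds h),
      nhdsWithin_le_nhds (isOpen_ne.mem_nhds h')] with x hx hx' using hgq x hx hx'
  -- contracting `γ` to `z₀`
  have hcontr : PeriodicSqEquiv (fun t => g (γ t)) fun _ => 1 := by
    have hmem : ∀ (s : unitInterval) t, z₀ + (s : ℝ) • (γ t - z₀) ∈ Ω := fun s t =>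
      hΩ.add_smul_sub_mem hz₀ (hγΩ t) s.2
    have h := periodicSqEquiv_of_family
      (fun (s : unitInterval) t => g (z₀ + (s : ℝ) • (γ t - z₀)))
      (hgc.comp_continuous (f := fun p : unitInterval × ℝ => z₀ + (p.1 : ℝ) • (γ p.2 - z₀))
        (by fun_prop) fun p => hmem _ _)
      (fun s t => hg0 _ (hmem s t)) (fun s t => by simp only [hp t]) 1 0
    simp only [Set.Icc.coe_one, one_smul, add_sub_cancel, Set.Icc.coe_zero, zero_smul,
      add_zero] at h
    refine h.trans ⟨fun _ => (g z₀) ^ (1 / 2 : ℂ), continuous_const, fun _ => rfl,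
      fun _ => Complex.cpow_half_ne_zero (hg0 _ hz₀), fun _ => ?_⟩
    rw [Complex.cpow_half_sq, mul_one]
  have hfac : (fun t => f (γ t)) = fun t => g (γ t) * (L₀ (γ t - z₀) * L₁ (γ t - z₁)) := by
    funext t
    have e₀ := sub_ne_zero.1 (hγ0 z₀ hz₀U t)
    have e₁ := sub_ne_zero.1 (hγ0 z₁ hz₁U t)
    rw [hgq _ e₀ e₁, hq]
    exact (div_mul_cancel₀ _ (mul_ne_zero (hLne L₀ hL₀ _ _ e₀) (hLne L₁ hL₁ _ _ e₁))).symm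
  -- Here it matters that there are two zeros: both factors have the class of `γ - z₁`.
  have hsq : PeriodicSqEquiv (fun t => (γ t - z₁) * (γ t - z₁)) fun _ => 1 :=
    .sq_of_eq (by fun_prop) (fun t => by simp only [hp t]) fun t => hγ0 z₁ hz₁U t
  have hlin' : PeriodicSqEquiv (fun t => L₀ (γ t - z₀) * L₁ (γ t - z₁)) fun _ => 1 :=
    (((hlin L₀ hL₀ z₀ hz₀U).trans hmove).mul (hlin L₁ hL₁ z₁ hz₁U)).trans hsq
  rw [hfac]
  simpa using hcontr.mul hlin'

/-! ### Discriminant and spectrum of a `2 × 2` matrix -/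

open Matrix in
lemma discriminant2_eq_sq {A : ParamPlane → Matrix (Fin 2) (Fin 2) ℂ} {ξ : ParamPlane}
    {V : Matrix (Fin 2) (Fin 2) ℂ} (hV : IsUnit V.det) {d : Fin 2 → ℂ}
    (h : A ξ = V * diagonal d * V⁻¹) : discriminant2 A ξ = (d 0 - d 1) ^ 2 := by
  have htr : (A ξ).trace = d 0 + d 1 := by
    rw [h, trace_mul_comm, ← mul_assoc, nonsing_inv_mul _ hV, one_mul, trace_diagonal,
      Fin.sum_univ_two]
  have hdet : (A ξ).det = d 0 * d 1 := by
    rw [h, det_mul, det_mul, mul_right_comm, ← det_mul, mul_nonsing_inv _ hV, det_one, one_mul,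
      det_diagonal, Fin.prod_univ_two]
  rw [trace_fin_two] at htr
  rw [det_fin_two] at hdet
  rw [discriminant2]
  linear_combination (A ξ 0 0 + A ξ 1 1 + d 0 + d 1) * htr - 4 * hdet

open Polynomial in
lemma discriminant2_ne_zero {A : ParamPlane → Matrix (Fin 2) (Fin 2) ℂ} {ξ : ParamPlane}
    (h : HasSimpleSpectrum (A ξ)) : discriminant2 A ξ ≠ 0 := by
  intro h0
  have hc : (A ξ).charpoly = (X - C ((A ξ).trace / 2)) ^ 2 := by
    have hd : (A ξ).det = ((A ξ).trace / 2) ^ 2 := by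
      rw [discriminant2] at h0
      rw [Matrix.det_fin_two, Matrix.trace_fin_two]
      linear_combination -h0 / 4
    have ht : C (A ξ).trace = 2 * C ((A ξ).trace / 2) := by
      rw [← map_ofNat C, ← map_mul]
      congr 1
      ring
    rw [Matrix.charpoly_fin_two, hd, ht, C_pow]
    ring
  rw [HasSimpleSpectrum, hc, roots_pow, roots_X_sub_C, two_nsmul] at h
  simp at h

/-! ### Parallel transport and monodromy -/

open ComplexConjugate in
/-- A nonvanishing solution of `δ' = τ δ` with `τ` real has constant argument. -/
lemma exists_eq_norm_mul_of_hasDerivAt {δ τ : ℝ → ℂ} (hδ : ∀ t, HasDerivAt δ (δ t * τ t) t)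
    (hτ : ∀ t, (τ t).im = 0) (h0 : ∀ t, δ t ≠ 0) : ∃ c : ℂ, ∀ t, δ t = ‖δ t‖ * c := by
  have hc0 : ∀ t, conj (δ t) ≠ 0 := fun t => by simpa using h0 t
  have hder : ∀ t, HasDerivAt (fun t => δ t / conj (δ t)) 0 t := by
    intro t
    have h2 : HasDerivAt (fun t => conj (δ t)) (conj (δ t * τ t)) t := (hδ t).star
    refine ((hδ t).div h2 (hc0 t)).congr_deriv ?_
    rw [map_mul, Complex.conj_eq_iff_im.2 (hτ t)]
    ring
  have hconst : ∀ t, δ t / conj (δ t) = δ 0 / conj (δ 0) := fun t =>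
    is_const_of_deriv_eq_zero (fun t => (hder t).differentiableAt) (fun t => (hder t).deriv) t 0
  have hcont : Continuous δ := continuous_iff_continuousAt.2 fun t => (hδ t).continuousAt
  have hn : ∀ t, (‖δ t‖ : ℂ) ≠ 0 := fun t => by simpa using h0 t
  have hsq : ∀ t, (‖δ t‖ : ℂ) ^ 2 = δ t * conj (δ t) := fun t => by
    rw [Complex.mul_conj, Complex.normSq_eq_norm_sq]
    simp
  have hc : δ 0 / ‖δ 0‖ ≠ 0 := div_ne_zero (h0 0) (hn 0)
  -- `δ / conj δ` is the square of `δ / ‖δ‖`; its constancy fixes the latter up to a sign, which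
  -- continuity makes constant.
  have := isPreconnected_univ.eq_or_eq_neg_of_sq_eq (f := δ)
    (g := fun t => ‖δ t‖ * (δ 0 / ‖δ 0‖)) hcont.continuousOn
    (by fun_prop) (fun t _ => ?_) (fun {t} _ => mul_ne_zero (hn t) hc)
  · rcases this with h | h
    · exact ⟨_, fun t => h (Set.mem_univ t)⟩
    · refine ⟨-(δ 0 / ‖δ 0‖), fun t => ?_⟩
      rw [mul_neg]
      exact h (Set.mem_univ t)
  · have h1 := hconst t
    have h2 := hc0 t
    have h3 := hc0 0
    have h4 := h0 0
    simp only [Pi.pow_apply, mul_pow, div_pow, hsq]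
    rw [div_eq_div_iff h2 h3] at h1
    field_simp
    linear_combination δ t * h1

section Transport

open Matrix ComplexConjugate

variable {n : ℕ} {V : ℝ → Matrix (Fin n) (Fin n) ℂ}

lemma mul_transportMatrix (hV : ∀ t, IsUnit (V t).det) (t : ℝ) :
    V t * transportMatrix V t = matrixDeriv V t := by
  rw [transportMatrix, ← mul_assoc, mul_nonsing_inv _ (hV t), one_mul]

/-- Under the length condition, the columns of `V` have constant length. -/
lemma conjTranspose_mul_self_diag_const (hd : ∀ i j, Differentiable ℝ fun t => V t i j)
    (hV : ∀ t, IsUnit (V t).det) (hlen : SatisfiesConstantLength V) (j : Fin n) (s t : ℝ) :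
    ((V s)ᴴ * V s) j j = ((V t)ᴴ * V t) j j := by
  have hder : ∀ t, HasDerivAt (fun t => ((V t)ᴴ * V t) j j) 0 t := by
    intro t
    have h1 : ∀ i, HasDerivAt (fun t => V t i j) (matrixDeriv V t i j) t := fun i =>
      (hd i j t).hasDerivAt
    have h2 : ∀ i, HasDerivAt (fun t => conj (V t i j)) (conj (matrixDeriv V t i j)) t := fun i =>
      (h1 i).star
    have h3 : HasDerivAt (fun t => ∑ i, conj (V t i j) * V t i j)
        (∑ i, (conj (matrixDeriv V t i j) * V t i j + conj (V t i j) * matrixDeriv V t i j)) t :=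
      HasDerivAt.fun_sum fun i _ => (h2 i).mul (h1 i)
    -- The length condition is `Re (Vᴴ V P)_jj = 0` with the term `k = j` moved to the left.
    have hre : (((V t)ᴴ * matrixDeriv V t) j j).re = 0 := by
      rw [← mul_transportMatrix hV, ← mul_assoc, mul_apply, Complex.re_sum,
        ← Finset.add_sum_erase _ _ (Finset.mem_univ j), hlen t j, neg_add_cancel]
    have hz : ∑ i, (conj (matrixDeriv V t i j) * V t i j + conj (V t i j) * matrixDeriv V t i j)
        = 0 := by
      have e : ((V t)ᴴ * matrixDeriv V t) j j = ∑ i, conj (V t i j) * matrixDeriv V t i j := by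
        simp [mul_apply]
      rw [e] at hre
      have : ∑ i, conj (matrixDeriv V t i j) * V t i j =
          conj (∑ i, conj (V t i j) * matrixDeriv V t i j) := by
        rw [map_sum]
        exact Finset.sum_congr rfl fun i _ => by simp [mul_comm]
      rw [Finset.sum_add_distrib, this, add_comm, Complex.add_conj, hre]
      simp
    rw [hz] at h3
    simpa [mul_apply] using h3
  exact is_const_of_deriv_eq_zero (fun t => (hder t).differentiableAt) (fun t => (hder t).deriv) s t

lemma conjTranspose_mul_self_diag_ne_zero {M : Matrix (Fin n) (Fin n) ℂ} (hM : IsUnit M.det)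
    (j : Fin n) : (Mᴴ * M) j j ≠ 0 := by
  intro h
  have h1 : (Mᴴ * M) j j = ((∑ i, ‖M i j‖ ^ 2 : ℝ) : ℂ) := by
    rw [mul_apply]
    push_cast
    refine Finset.sum_congr rfl fun i _ => ?_
    rw [conjTranspose_apply, mul_comm]
    exact Complex.mul_conj' _
  rw [h1, Complex.ofReal_eq_zero, Finset.sum_eq_zero_iff_of_nonneg fun _ _ => by positivity] at h
  have h2 : ∀ i, M i j = 0 := fun i => by simpa using h i (Finset.mem_univ i)
  rw [det_eq_zero_of_column_eq_zero j h2] at hM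
  simp at hM

/-- If `V(t + 1) = V(t) diag(d(t))`, then `d` is constant of modulus one, under the
length and parallel transport conditions. -/
lemma monodromy_const (hd : ∀ i j, Differentiable ℝ fun t => V t i j)
    (hV : ∀ t, IsUnit (V t).det) (hlen : SatisfiesConstantLength V)
    (hpar : SatisfiesParallelTransport V) {d : Fin n → ℝ → ℂ}
    (hdV : ∀ t, V (t + 1) = V t * diagonal fun j => d j t) (j : Fin n) :
    (∀ t, ‖d j t‖ = 1) ∧ ∀ t, d j t = d j 0 := by
  have hentry : ∀ t i j, V (t + 1) i j = V t i j * d j t := fun t i j => by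
    rw [hdV, mul_diagonal]
  have hnorm : ∀ t, conj (d j t) * d j t = 1 := by
    intro t
    have h := conjTranspose_mul_self_diag_const hd hV hlen j (t + 1) t
    have h0 := conjTranspose_mul_self_diag_ne_zero (hV t) j
    have : ((V (t + 1))ᴴ * V (t + 1)) j j = conj (d j t) * d j t * ((V t)ᴴ * V t) j j := by
      simp only [mul_apply, conjTranspose_apply, hentry, Finset.mul_sum, star_mul']
      refine Finset.sum_congr rfl fun i _ => ?_
      simp only [Complex.star_def]
      ring
    rw [this] at h
    exact mul_right_cancel₀ h0 (h.trans (one_mul _).symm)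
  have hdd : ∀ k, Differentiable ℝ (d k) := by
    intro k
    have h0 := conjTranspose_mul_self_diag_ne_zero (hV 0) k
    -- Projecting `v_k(t + 1)` onto `v_k(t)` expresses `d k` by differentiable functions over a
    -- constant.
    have e : d k = fun t => (∑ i, conj (V t i k) * V (t + 1) i k) / ((V 0)ᴴ * V 0) k k := by
      funext t
      rw [eq_div_iff h0, conjTranspose_mul_self_diag_const hd hV hlen k 0 t]
      simp only [mul_apply, conjTranspose_apply, hentry, Finset.mul_sum]
      refine Finset.sum_congr rfl fun i _ => ?_
      simp only [Complex.star_def]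
      ring
    rw [e]
    refine Differentiable.div_const (Differentiable.fun_sum fun i _ => ?_) _
    have h1 : Differentiable ℝ fun t => conj (V t i k) := (hd i k).star
    have h2 : Differentiable ℝ fun t => V (t + 1) i k := (hd i k).comp (by fun_prop)
    exact h1.mul h2
  have hP : ∀ t, d j t * transportMatrix V (t + 1) j j =
      transportMatrix V t j j * d j t + deriv (d j) t := by
    intro t
    have hD : matrixDeriv V (t + 1) = matrixDeriv V t * diagonal (fun k => d k t) +
        V t * diagonal fun k => deriv (d k) t := by
      ext i k
      rw [Matrix.add_apply, mul_diagonal, mul_diagonal]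
      simp only [matrixDeriv, of_apply]
      rw [← deriv_comp_add_const (f := fun s => V s i k)]
      simp only [hentry]
      exact deriv_fun_mul (hd i k t) (hdd k t)
    rw [← mul_transportMatrix hV, ← mul_transportMatrix hV, hdV, mul_assoc, mul_assoc,
      ← mul_add] at hD
    have hD' := congrArg (fun M => (V t)⁻¹ * M) hD
    simp only [← mul_assoc, nonsing_inv_mul _ (hV t), one_mul] at hD'
    have := congrFun (congrFun hD' j) j
    simpa [diagonal_mul, mul_diagonal] using this
  have hder : ∀ t, deriv (d j) t = 0 := by
    intro t
    -- `d' = d ρ` with `ρ` real, so differentiating `conj d * d = 1` gives `2ρ = 0`.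
    set ρ : ℂ := transportMatrix V (t + 1) j j - transportMatrix V t j j with hρ
    have hρ' : conj ρ = ρ := Complex.conj_eq_iff_im.2 (by rw [hρ, Complex.sub_im, hpar, hpar,
      sub_zero])
    have e : deriv (d j) t = d j t * ρ := by
      rw [hρ]
      linear_combination -hP t
    have h1 : HasDerivAt (d j) (d j t * ρ) t := e ▸ (hdd j t).hasDerivAt
    have h2 : HasDerivAt (fun t => conj (d j t)) (conj (d j t * ρ)) t := h1.star
    have h3 := h2.mul h1
    have h4 : (fun t => conj (d j t)) * d j = fun _ => 1 := funext hnorm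
    rw [h4] at h3
    have h5 := h3.unique (hasDerivAt_const t (1 : ℂ))
    rw [map_mul, hρ'] at h5
    have : ρ = 0 := by linear_combination h5 / 2 - ρ * hnorm t
    rw [e, this, mul_zero]
  refine ⟨fun t => ?_, fun t => is_const_of_deriv_eq_zero (hdd j) hder t 0⟩
  have h := hnorm t
  rw [Complex.conj_mul'] at h
  have h' : ‖d j t‖ ^ 2 = 1 := by exact_mod_cast h
  exact (pow_eq_one_iff_of_nonneg (norm_nonneg _) two_ne_zero).1 h'

/-- Liouville's formula for `V̇ = V P`. -/
lemma hasDerivAt_det_fin_two {V : ℝ → Matrix (Fin 2) (Fin 2) ℂ}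
    (hd : ∀ i j, Differentiable ℝ fun t => V t i j) (hV : ∀ t, IsUnit (V t).det) (t : ℝ) :
    HasDerivAt (fun t => (V t).det) ((V t).det * (transportMatrix V t).trace) t := by
  have h1 : ∀ i j, HasDerivAt (fun t => V t i j) (matrixDeriv V t i j) t := fun i j =>
    (hd i j t).hasDerivAt
  simp only [det_fin_two, trace_fin_two]
  refine (((h1 0 0).mul (h1 1 1)).sub ((h1 0 1).mul (h1 1 0))).congr_deriv ?_
  rw [← mul_transportMatrix hV]
  simp only [mul_apply, Fin.sum_univ_two]
  ring

end Transport

/-! ### The discriminant around generic cuspidal points -/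

/-- The complex derivative datum of the discriminant at a generic cuspidal point. -/
lemma IsGenericCuspidalPoint.exists_hasFDerivAt {A : ParamPlane → Matrix (Fin 2) (Fin 2) ℂ}
    {ξ : ParamPlane} (h : IsGenericCuspidalPoint A ξ) (e : ℂ ≃L[ℝ] ParamPlane)
    (he : ∀ z, e z = !₂[z.re, z.im]) :
    discriminant2 A ξ = 0 ∧ ∃ L : ℂ →L[ℝ] ℂ, Function.Injective L ∧
      HasFDerivAt (fun z => discriminant2 A (e z)) L (e.symm ξ) := by
  have hF : ∀ ξ, e.symm (discriminantMap A ξ) = discriminant2 A ξ := fun ξ => by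
    rw [e.symm_apply_eq, he]
    rfl
  obtain ⟨h0, M, hM⟩ := h
  refine ⟨by rw [← hF, h0, map_zero], ?_⟩
  -- `fderiv` is 0 where the map is not differentiable, and 0 is not invertible on the plane.
  have hd : DifferentiableAt ℝ (discriminantMap A) ξ := by
    by_contra hn
    rw [fderiv_zero_of_not_differentiableAt hn] at hM
    have h1 : ∀ x, M x = 0 := fun x => congrArg (fun T : ParamPlane →L[ℝ] ParamPlane => T x) hM
    exact one_ne_zero (e.injective (M.injective ((h1 (e 1)).trans (h1 (e 0)).symm)))
  have hd' : HasFDerivAt (discriminantMap A) (M : ParamPlane →L[ℝ] ParamPlane)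
      (e (e.symm ξ)) := by
    rw [hM, e.apply_symm_apply]
    exact hd.hasFDerivAt
  refine ⟨((e.trans M).trans e.symm : ℂ ≃L[ℝ] ℂ), ((e.trans M).trans e.symm).injective, ?_⟩
  have := e.symm.hasFDerivAt.comp (e.symm ξ) (hd'.comp (e.symm ξ) e.hasFDerivAt)
  refine (this.congr_of_eventuallyEq (Eventually.of_forall fun z => ?_))
  exact (hF _).symm

/-- Along a loop around two generic cuspidal points, the discriminant has a continuous
periodic square root. -/
lemma periodicSqEquiv_discriminant2 {Ω : Set ParamPlane} (hΩc : Convex ℝ Ω)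
    {A : ParamPlane → Matrix (Fin 2) (Fin 2) ℂ} (hA : ∀ i j, ContinuousOn (fun ξ => A ξ i j) Ω)
    {ξ₀ ξ₁ : ParamPlane} (hξ₀ : ξ₀ ∈ Ω) (hne : ξ₀ ≠ ξ₁)
    (hgcp₀ : IsGenericCuspidalPoint A ξ₀) (hgcp₁ : IsGenericCuspidalPoint A ξ₁)
    (hsimple : ∀ ξ ∈ Ω \ {ξ₀, ξ₁}, HasSimpleSpectrum (A ξ))
    {γ : ℝ → ParamPlane} (hγ : Continuous γ) (hp : Function.Periodic γ 1)
    (hγΩ : Set.range γ ⊆ Ω) {U : Set ParamPlane} (hU : IsPreconnected U)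
    (hγU : ∀ t, γ t ∉ U) (hξ₀U : ξ₀ ∈ U) (hξ₁U : ξ₁ ∈ U) :
    PeriodicSqEquiv (fun t => discriminant2 A (γ t)) fun _ => 1 := by
  obtain ⟨e, he⟩ : ∃ e : ℂ ≃L[ℝ] ParamPlane, ∀ z, e z = !₂[z.re, z.im] := by
    refine ⟨Complex.orthonormalBasisOneI.repr.toContinuousLinearEquiv, fun z => ?_⟩
    ext i
    fin_cases i <;> simp
  obtain ⟨h₀, L₀, hL₀, hd₀⟩ := hgcp₀.exists_hasFDerivAt e he
  obtain ⟨h₁, L₁, hL₁, hd₁⟩ := hgcp₁.exists_hasFDerivAt e he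
  have hdisc : ContinuousOn (discriminant2 A) Ω :=
    (((hA 0 0).sub (hA 1 1)).pow 2).add ((continuousOn_const.mul (hA 0 1)).mul (hA 1 0))
  have h := exists_periodic_sqrt_comp (Ω := e ⁻¹' Ω) (U := e.symm '' U)
    (f := fun z => discriminant2 A (e z)) (z₀ := e.symm ξ₀) (z₁ := e.symm ξ₁)
    (γ := fun t => e.symm (γ t))
    (hΩc.linear_preimage (e : ℂ →ₗ[ℝ] ParamPlane))
    (hdisc.comp e.continuous.continuousOn fun z hz => hz) (e.symm.injective.ne hne)
    (by simpa using hξ₀)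
    (fun z hz h0 h1 => discriminant2_ne_zero (hsimple _ ⟨hz, ?_⟩))
    (by simpa using h₀) (by simpa using h₁) hd₀ hd₁ hL₀ hL₁
    (e.symm.continuous.comp hγ) (fun t => by simp only [hp t])
    (fun t => by simpa using hγΩ ⟨t, rfl⟩)
    (hU.image _ e.symm.continuous.continuousOn) (fun t => ?_) ⟨_, hξ₀U, rfl⟩ ⟨_, hξ₁U, rfl⟩
  · simpa using h
  · rintro (h | h)
    · exact h0 (by rw [← h, e.symm_apply_apply])
    · exact h1 (by rw [← Set.mem_singleton_iff.1 h, e.symm_apply_apply])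
  · rintro ⟨x, hx, hxt⟩
    exact hγU t (e.symm.injective hxt ▸ hx)

/-! ### The main theorem -/

theorem theorem3p9
    (k : WithTop ℕ∞) (hk : 1 ≤ k)
    (Ω : Set ParamPlane) (hΩ : IsOpen Ω) (hΩc : Convex ℝ Ω)
    (A : ParamPlane → Matrix (Fin 2) (Fin 2) ℂ) (hA : MatrixContDiffOn k A Ω)
    (ξ₀ ξ₁ : ParamPlane) (hξ₀ : ξ₀ ∈ Ω) (hξ₁ : ξ₁ ∈ Ω) (hne : ξ₀ ≠ ξ₁)
    (hgcp₀ : IsGenericCuspidalPoint A ξ₀) (hgcp₁ : IsGenericCuspidalPoint A ξ₁)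
    (hsimple : ∀ ξ ∈ Ω \ {ξ₀, ξ₁}, HasSimpleSpectrum (A ξ))
    (γ : ℝ → ParamPlane) (hγ : IsSmoothJordanCurve γ) (hγΩ : Set.range γ ⊆ Ω)
    (U : Set ParamPlane) (hU : IsInteriorOfCurve γ U) (hξ₀U : ξ₀ ∈ U) (hξ₁U : ξ₁ ∈ U)
    (V : ℝ → Matrix (Fin 2) (Fin 2) ℂ) (lam : Fin 2 → ℝ → ℂ)
    (hdec : IsEigendecomposition k (fun t => A (γ t)) V lam)
    (hlen : SatisfiesConstantLength V) (hpar : SatisfiesParallelTransport V) :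
    (∀ t : ℝ, lam 0 (t + 1) = lam 0 t ∧ lam 1 (t + 1) = lam 1 t) ∧
    ∃ α₁ α₂ : ℝ,
      (∀ t : ℝ, (V t)⁻¹ * V (t + 1) =
        Matrix.diagonal ![Complex.exp (Complex.I * α₁), Complex.exp (Complex.I * α₂)]) ∧
      ∃ m : ℤ, α₁ + α₂ = 2 * Real.pi * m := by
  obtain ⟨⟨x, hx, rfl⟩, -⟩ := hU
  have hγU : ∀ t, γ t ∉ connectedComponentIn (Set.range γ)ᶜ x := fun t ht =>
    connectedComponentIn_subset _ _ ht ⟨t, rfl⟩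
  have hk0 : k ≠ 0 := (zero_lt_one.trans_le hk).ne'
  have hV := hdec.isUnit_det
  have hd : ∀ i j, Differentiable ℝ fun t => V t i j := fun i j =>
    (hdec.contDiff_vectors i j).differentiable hk0
  have hlamc : ∀ j, Continuous (lam j) := fun j => (hdec.contDiff_values j).continuous
  -- the eigenvalues are periodic
  obtain ⟨r, hr, hrp, hr0, hrsq⟩ := periodicSqEquiv_discriminant2 hΩc
    (fun i j => (hA i j).continuousOn) hξ₀ hne hgcp₀ hgcp₁ hsimple hγ.contDiff.continuous
    hγ.periodic hγΩ isPreconnected_connectedComponentIn hγU hξ₀U hξ₁U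
  have hsq : ∀ t, (lam 0 t - lam 1 t) ^ 2 = r t ^ 2 := fun t => by
    rw [← discriminant2_eq_sq (A := A) (ξ := γ t) (hV t) (hdec.eq t)]
    exact (hrsq t).trans (mul_one _)
  have hlam0 : ∀ t, lam 0 t - lam 1 t ≠ 0 := fun t h => by
    have := hsq t
    rw [h, zero_pow two_ne_zero] at this
    exact pow_ne_zero 2 (hr0 t) this.symm
  -- By connectedness of the line, the difference is `r` throughout or `-r` throughout.
  have hsub : ∀ t, lam 0 (t + 1) - lam 1 (t + 1) = lam 0 t - lam 1 t := by
    rcases isPreconnected_univ.eq_or_eq_neg_of_sq_eq (f := fun t => lam 0 t - lam 1 t)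
      ((hlamc 0).sub (hlamc 1)).continuousOn hr.continuousOn (fun t _ => hsq t)
      (fun {t} _ => hr0 t) with h | h
    · intro t
      have h1 := h (Set.mem_univ (t + 1))
      have h2 := h (Set.mem_univ t)
      simp only at h1 h2
      rw [h1, h2, hrp t]
    · intro t
      have h1 := h (Set.mem_univ (t + 1))
      have h2 := h (Set.mem_univ t)
      simp only [Pi.neg_apply] at h1 h2
      rw [h1, h2, hrp t]
  have htr : ∀ t, lam 0 t + lam 1 t = (A (γ t)).trace := fun t => by
    have : A (γ t) = _ := hdec.eq t
    rw [this, Matrix.trace_mul_comm, ← mul_assoc, Matrix.nonsing_inv_mul _ (hV t), one_mul,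
      Matrix.trace_diagonal, Fin.sum_univ_two]
  have hadd : ∀ t, lam 0 (t + 1) + lam 1 (t + 1) = lam 0 t + lam 1 t := fun t => by
    rw [htr, htr, hγ.periodic t]
  have hlam : ∀ t, lam 0 (t + 1) = lam 0 t ∧ lam 1 (t + 1) = lam 1 t := fun t =>
    ⟨by linear_combination (hadd t + hsub t) / 2, by linear_combination (hadd t - hsub t) / 2⟩
  refine ⟨hlam, ?_⟩
  -- the monodromy matrix is diagonal
  set d : Fin 2 → ℝ → ℂ := fun j t => ((V t)⁻¹ * V (t + 1)) j j with hddef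
  have hW : ∀ t, (V t)⁻¹ * V (t + 1) = Matrix.diagonal fun j => d j t := by
    intro t
    have h1 : A (γ t) * V t = V t * Matrix.diagonal (fun j => lam j t) := by
      have : A (γ t) = _ := hdec.eq t
      rw [this, mul_assoc, Matrix.nonsing_inv_mul _ (hV t), mul_one]
    have h2 : A (γ t) * V (t + 1) = V (t + 1) * Matrix.diagonal (fun j => lam j t) := by
      have := hdec.eq (t + 1)
      simp only [hγ.periodic t] at this
      have hl : (fun j => lam j (t + 1)) = fun j => lam j t :=
        funext fun j => by fin_cases j; exacts [(hlam t).1, (hlam t).2]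
      rw [this, mul_assoc, Matrix.nonsing_inv_mul _ (hV _), mul_one, hl]
    -- A matrix commuting with a diagonal one with distinct entries is diagonal.
    have h3 : Matrix.diagonal (fun j => lam j t) * ((V t)⁻¹ * V (t + 1)) =
        ((V t)⁻¹ * V (t + 1)) * Matrix.diagonal (fun j => lam j t) := by
      have h4 : A (γ t) = V t * Matrix.diagonal (fun j => lam j t) * (V t)⁻¹ := hdec.eq t
      rw [mul_assoc, ← h2, h4]
      simp only [← mul_assoc]
      rw [Matrix.nonsing_inv_mul _ (hV t), one_mul]
    have h01 := congrFun (congrFun h3 0) 1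
    have h10 := congrFun (congrFun h3 1) 0
    rw [Matrix.diagonal_mul, Matrix.mul_diagonal] at h01 h10
    have e01 : ((V t)⁻¹ * V (t + 1)) 0 1 = 0 :=
      (mul_eq_zero.1 (by linear_combination h01)).resolve_left (hlam0 t)
    have e10 : ((V t)⁻¹ * V (t + 1)) 1 0 = 0 :=
      (mul_eq_zero.1 (by linear_combination -h10)).resolve_left (hlam0 t)
    ext i j
    fin_cases i <;> fin_cases j
    · simp [hddef]
    · simpa using e01
    · simpa using e10
    · simp [hddef]
  have hdV : ∀ t, V (t + 1) = V t * Matrix.diagonal fun j => d j t := fun t => by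
    rw [← hW, ← mul_assoc, Matrix.mul_nonsing_inv _ (hV t), one_mul]
  have hmono := monodromy_const hd hV hlen hpar hdV
  -- its determinant is one
  have hprod : d 0 0 * d 1 0 = 1 := by
    have hδ0 : ∀ t, (V t).det ≠ 0 := fun t => (hV t).ne_zero
    obtain ⟨c, hc⟩ := exists_eq_norm_mul_of_hasDerivAt (hasDerivAt_det_fin_two hd hV)
      (fun t => by rw [Matrix.trace_fin_two, Complex.add_im, hpar, hpar, add_zero]) hδ0
    have h1 : (V (0 + 1)).det = (V 0).det * (d 0 0 * d 1 0) := by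
      rw [hdV, Matrix.det_mul, Matrix.det_diagonal, Fin.prod_univ_two]
    -- Equal modulus and equal argument give `det V(1) = det V(0)`.
    have h2 : ‖(V (0 + 1)).det‖ = ‖(V 0).det‖ := by
      rw [h1, norm_mul, norm_mul, (hmono 0).1, (hmono 1).1, mul_one, mul_one]
    rw [hc (0 + 1), h2, ← hc 0] at h1
    exact mul_left_cancel₀ (hδ0 0) (h1.symm.trans (mul_one _).symm)
  have hexp : ∀ j, d j 0 = Complex.exp (Complex.I * (d j 0).arg) := fun j => by
    have := Complex.norm_mul_exp_arg_mul_I (d j 0)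
    rw [(hmono j).1 0, Complex.ofReal_one, one_mul, mul_comm] at this
    exact this.symm
  refine ⟨(d 0 0).arg, (d 1 0).arg, fun t => ?_, ?_⟩
  · rw [hW, ← hexp, ← hexp]
    congr 1
    funext j
    fin_cases j
    exacts [(hmono 0).2 t, (hmono 1).2 t]
  · rw [hexp 0, hexp 1, ← Complex.exp_add, Complex.exp_eq_one_iff] at hprod
    obtain ⟨m, hm⟩ := hprod
    refine ⟨m, ?_⟩
    have : ((d 0 0).arg + (d 1 0).arg : ℂ) = 2 * Real.pi * m :=
      mul_left_cancel₀ Complex.I_ne_zero (by linear_combination hm)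
    exact_mod_cast this
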